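/- Let $(\mathbb M,\tau,\oplus)$ be an abelian topological monoid (with jointly continuous operation) with neutral element $\boldsymbol e$, where $\tau$ is locally compact, second countable and Hausdorff, and $\mathbb M$ carries its Borel $\sigma$-algebra. A character is a Borel measurable map $\chi:\mathbb M\to[0,1]$ with $\chi(\boldsymbol e)=1$ and $\chi(x\oplus y)=\chi(x)\chi(y)$. Suppose $(\mathbb M,\widetilde{\mathbb M})$ is a Feller topological monoid, that is, $\widetilde{\mathbb M}$ is a non-empty countable set of characters, closed under pointwise multiplication, such that for every sequence $(x_n)$ in $\mathbb M$: (i) $\chi(x_n)\to0$ for all $\chi\in\widetilde{\mathbb M}$ if and only if $(x_n)$ eventually leaves every compact set; (ii) if $\chi(x_n)\to\psi(\chi)$ for every $\chi\in\widetilde{\mathbb M}$ and $\psi\not\equiv0$, then there is $x\in\mathbb M$ with $x_n\to x$ and $\psi(\chi)=\chi(x)$ for all $\chi\in\widetilde{\mathbb M}$. Let $\Pi$ be a $\sigma$-finite measure on $\mathbb M$ with $\int_{\mathbb M}(1-\chi)\,d\Pi<\infty$ for every $\chi\in\widetilde{\mathbb M}$, and let $\mathcal N=\sum_i\delta_{(t_i,x_i)}$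 (almost surely, the sum being over a random countable index set) be a Poisson point process on $(0,\infty)\times\mathbb M$ with intensity $dt\otimes\Pi$, defined on a probability space $(\Omega,\mathscr F,\mathbb P)$. For $t\ge0$ put $X_t:=\bigoplus_{t_i\le t}x_i$, and for $0\le s\le t$ put $X_{s,t}:=\bigoplus_{s<t_i\le t}x_i$ (with any fixed value where the sum does not converge). Then: 1. Almost surely, for all $0\le s\le t$ the sums defining $X_t$ and $X_{s,t}$ converge unconditionally in $\mathbb M$, and $X_t=X_s\oplus X_{s,t}$. 2. $(X_t)_{t\ge0}$ is a subordinator: each $X_t$ is a random element of $\mathbb M$ (measurable up to a null set); $X_0=\boldsymbol e$; almost surely $t\mapsto X_t$ is right-continuous on $[0,\infty)$; and for all $s,t\ge0$ there is, on some enlargement of $(\Omega,\mathscr F,\mathbb P)$, a random element $X^{(t)}_s$ with the law of $X_s$ and independent of $X_t$ such that $X_{s+t}$ has the same law as $X^{(t)}_s\oplus X_t$. 3. The $\oplus$-increments are stationary and independent: $X_{t,t+s}$ has the law of $X_s$ for all $s,t\ge0$, and for every nondecreasing sequence $0\le r_0\le r_1\le\cdots$ the random elements $X_{r_0,r_1},X_{r_1,r_2},\dots$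 are independent. -/

import Mathlib

open MeasureTheory ProbabilityTheory Filter Topology
open scoped NNReal ENNReal

namespace FellerMonoid

/-- A (Borel measurable) character on the commutative monoid `(M, +, 0)`: a measurable map
`χ : M → [0,1]` with `χ 0 = 1` and `χ (x + y) = χ x * χ y`. The monoid operation is written
additively. -/
structure IsCharacter {M : Type*} [AddCommMonoid M] [MeasurableSpace M] (χ : M → ℝ) : Prop where
  measurable : Measurable χ
  nonneg : ∀ x, 0 ≤ χ x
  le_one : ∀ x, χ x ≤ 1
  map_zero : χ 0 = 1
  map_add : ∀ x y, χ (x + y) = χ x * χ y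

/-- `S` is a determining class of characters on the abelian topological monoid `M`. For a locally
compact second countable Hausdorff `M` with its Borel σ-algebra, this says that `(M, S)` is a
Feller topological monoid. Convergence to the point at infinity of the Alexandroff extension is
convergence along `cocompact M`, i.e. the sequence eventually leaves every compact set. -/
structure IsDeterminingClass {M : Type*} [AddCommMonoid M] [TopologicalSpace M]
    [MeasurableSpace M] (S : Set (M → ℝ)) : Prop where
  nonempty : S.Nonempty
  countable : S.Countable
  isCharacter : ∀ χ ∈ S, IsCharacter χ
  mul_mem : ∀ χ₁ ∈ S, ∀ χ₂ ∈ S, (fun x => χ₁ x * χ₂ x) ∈ S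
  tendsto_zero_iff : ∀ x : ℕ → M,
    (∀ χ ∈ S, Tendsto (fun n => χ (x n)) atTop (𝓝 0)) ↔ Tendsto x atTop (cocompact M)
  tendsto_of_ne_zero : ∀ (x : ℕ → M) (ψ : S → ℝ),
    (∀ χ : S, Tendsto (fun n => χ.1 (x n)) atTop (𝓝 (ψ χ))) → (∃ χ : S, ψ χ ≠ 0) →
      ∃ y : M, Tendsto x atTop (𝓝 y) ∧ ∀ χ : S, ψ χ = χ.1 y

/-- `N` is a Poisson point process (Poisson random measure) on `E` with intensity measure `Λ`,
defined on `(Ω, P)`: `N A` is Poisson distributed with parameter `Λ A` (almost surely infinite if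
`Λ A = ∞`), and `N A₁, …, N Aₙ` are independent for pairwise disjoint `A₁, …, Aₙ`. -/
structure IsPoissonPointProcess {Ω E : Type*} [MeasurableSpace Ω] [MeasurableSpace E]
    (P : Measure Ω) (N : Ω → Measure E) (Λ : Measure E) : Prop where
  measurable : Measurable N
  map_eq : ∀ A, MeasurableSet A → Λ A ≠ ∞ →
    P.map (fun ω => N ω A) = (poissonMeasure (Λ A).toNNReal).map (fun k : ℕ => (k : ℝ≥0∞))
  eq_top : ∀ A, MeasurableSet A → Λ A = ∞ → ∀ᵐ ω ∂P, N ω A = ∞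
  iIndepFun : ∀ (n : ℕ) (A : Fin n → Set E), (∀ k, MeasurableSet (A k)) →
    Pairwise (fun j k => Disjoint (A j) (A k)) → iIndepFun (fun k ω => N ω (A k)) P

/-- The indices `i` of those atoms `ξ i = (tᵢ, xᵢ)`, `i ∈ J`, whose time `tᵢ` lies in `B`. -/
def atomsIn {M : Type*} (J : Set ℕ) (ξ : ℕ → Set.Ioi (0 : ℝ) × M) (B : Set ℝ) : Set ℕ :=
  {i | i ∈ J ∧ ((ξ i).1 : ℝ) ∈ B}

/-- The sum of the family of all marks `xᵢ` with `tᵢ ∈ B` converges in `M`, unconditionally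
(hence irrespective of the order of the summands). -/
def AtomSummable {M : Type*} [AddCommMonoid M] [TopologicalSpace M] (J : Set ℕ)
    (ξ : ℕ → Set.Ioi (0 : ℝ) × M) (B : Set ℝ) : Prop :=
  Summable (fun i : atomsIn J ξ B => (ξ i).2)

/-- The sum of all marks `xᵢ` with `tᵢ ∈ B`. -/
noncomputable def atomSum {M : Type*} [AddCommMonoid M] [TopologicalSpace M] (J : Set ℕ)
    (ξ : ℕ → Set.Ioi (0 : ℝ) × M) (B : Set ℝ) : M :=
  ∑' i : atomsIn J ξ B, (ξ i).2

/-- `X` is an `M`-valued subordinator on `(Ω, P)`: it starts at the neutral element, almost every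
path is right-continuous, and for all `s, t ≥ 0` there is, on some enlargement `(Ω', P')` of
`(Ω, P)`, a random element `Z` with the law of `X s`, independent of `X t`, such that `X (s + t)`
has the law of `Z + X t`. -/
structure IsSubordinator.{u, v} {Ω : Type u} {M : Type v} [MeasurableSpace Ω] [AddCommMonoid M]
    [TopologicalSpace M] [MeasurableSpace M] (P : Measure Ω) (X : ℝ≥0 → Ω → M) : Prop where
  aemeasurable : ∀ t, AEMeasurable (X t) P
  zero : ∀ ω, X 0 ω = 0
  rightContinuous : ∀ᵐ ω ∂P, ∀ t, ContinuousWithinAt (fun r => X r ω) (Set.Ici t) t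
  increments : ∀ t s, ∃ (Ω' : Type (max u v)) (_ : MeasurableSpace Ω') (P' : Measure Ω')
    (π : Ω' → Ω) (Z : Ω' → M), MeasurePreserving π P' P ∧
      IdentDistrib Z (X s) P' P ∧ IndepFun Z (fun ω' => X t (π ω')) P' ∧
      IdentDistrib (X (s + t)) (fun ω' => Z ω' + X t (π ω')) P P'

end FellerMonoid

/-!
The characters of a determining class `S` turn every question about `M` into one about `[0, 1]`.

The class separates points, its members are continuous (by compactness of `[0, 1] ^ S`), and a
filter on `M` converges as soon as all characters converge along it and their limits do not all
vanish (`IsDeterminingClass.exists_tendsto`). Hence evaluation embeds `M` as a closed subset of the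
nonzero functions on `S`, so that `M` is Polish, and by a Stone-Weierstrass argument the numbers
`E χ(X)`, `χ ∈ S`, determine the law of a random element `X` of `M`
(`IsDeterminingClass.measure_ext`, and `IsDeterminingClass.measure_pi_ext` for random vectors).

Pathwise: by Campbell's formula, almost surely `∑ (1 - χ(xᵢ)) < ∞` over the atoms up to any finite
time, for all `χ ∈ S` (`IsPoissonPointProcess.ae_locallySummable`). Outside finitely many atoms this
sum is at most `1 / 2` for one fixed `χ`, so `χ` of any partial sum is at least `1 / 2`. Every
character decreases along the partial sums, hence converges, and the limits are not all zero: the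
sum converges unconditionally (`IsDeterminingClass.summable`). Additivity is then formal, and
right-continuity follows from `1 - χ(X_{t,r}) ≤ ∑_{t < tᵢ ≤ r} (1 - χ(xᵢ)) → 0` as `r ↓ t`.

In law: `χ(X_B) = exp (-∫ 1_B(t) (-log χ(x)) dN)`, so the Laplace functional of the Poisson process,
`E exp (-∫ f dN) = exp (-∫ (1 - exp (-f)) dΛ)` (`IsPoissonPointProcess.lintegral_expNeg`), gives
`E ∏ₖ χₖ(X_{Bₖ}) = ∏ₖ exp (-|Bₖ| ∫ (1 - χₖ) dν)` for disjoint time sets `Bₖ`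
(`IsPoissonPointProcess.lintegral_prod_map_atomSum`). Stationarity, independence and the
subordinator property are read off from this formula. As characters may vanish, logarithms and
exponentials are taken on `[0, ∞]`. The same representation of `χ(X_B)` as a functional of `N`
gives measurability, since the enumeration of the atoms need not depend measurably on `ω`.
-/

open MeasureTheory ProbabilityTheory Filter Topology
open scoped NNReal ENNReal

namespace FellerMonoid

/-! ### Determining classes of characters -/

section Topology

variable {M : Type*} [AddCommMonoid M] [TopologicalSpace M] [MeasurableSpace M]
  {S : Set (M → ℝ)}

/-- The point `x` itself does not escape to infinity, so some character of `S` is nonzero at it. -/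
lemma IsDeterminingClass.exists_ne_zero (hS : IsDeterminingClass S) (x : M) :
    ∃ χ : S, χ.1 x ≠ 0 := by
  by_contra! h
  have h1 : Tendsto (fun _ : ℕ => x) atTop (cocompact M) := by
    rw [← hS.tendsto_zero_iff]
    intro χ hχ
    have hx : χ x = 0 := h ⟨χ, hχ⟩
    simp [hx]
  have h2 := h1.eventually (isCompact_singleton (x := x)).compl_mem_cocompact
  obtain ⟨n, hn⟩ := h2.exists
  exact hn rfl

lemma IsDeterminingClass.eq_of_forall_eq [T2Space M] (hS : IsDeterminingClass S) {x y : M}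
    (h : ∀ χ ∈ S, χ x = χ y) : x = y := by
  -- the alternating sequence `x, y, x, y, …` must converge
  obtain ⟨z, hz, -⟩ := hS.tendsto_of_ne_zero (fun n => if Even n then x else y) (fun χ => χ.1 x)
    (fun χ => by
      refine tendsto_const_nhds.congr fun n => ?_
      split_ifs
      · rfl
      · exact h χ.1 χ.2) (hS.exists_ne_zero x)
  have hx : z = x := by
    have h1 : Tendsto (fun n : ℕ => 2 * n) atTop atTop :=
      tendsto_atTop_atTop.2 fun b => ⟨b, fun a _ => by omega⟩
    refine tendsto_nhds_unique (hz.comp h1) (tendsto_const_nhds.congr fun n => ?_)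
    simp
  have hy : z = y := by
    have h1 : Tendsto (fun n : ℕ => 2 * n + 1) atTop atTop :=
      tendsto_atTop_atTop.2 fun b => ⟨b, fun a _ => by omega⟩
    refine tendsto_nhds_unique (hz.comp h1) (tendsto_const_nhds.congr fun n => ?_)
    simp
  exact hx.symm.trans hy

/-- The sequential convergence criterion holds along every countably generated filter. -/
lemma IsDeterminingClass.exists_tendsto [T2Space M] (hS : IsDeterminingClass S) {α : Type*}
    {l : Filter α} [l.NeBot] [l.IsCountablyGenerated] {u : α → M} {ψ : S → ℝ}
    (hu : ∀ χ : S, Tendsto (fun a => χ.1 (u a)) l (𝓝 (ψ χ))) (hψ : ∃ χ, ψ χ ≠ 0) :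
    ∃ y, Tendsto u l (𝓝 y) ∧ ∀ χ : S, ψ χ = χ.1 y := by
  obtain ⟨ns, hns⟩ := exists_seq_tendsto l
  obtain ⟨y, -, hy⟩ := hS.tendsto_of_ne_zero (u ∘ ns) ψ (fun χ => (hu χ).comp hns) hψ
  refine ⟨y, tendsto_of_seq_tendsto fun ms hms => ?_, hy⟩
  obtain ⟨z, hz, hz'⟩ := hS.tendsto_of_ne_zero (u ∘ ms) ψ (fun χ => (hu χ).comp hms) hψ
  rwa [hS.eq_of_forall_eq (x := y) (y := z) fun χ hχ =>
    (hy ⟨χ, hχ⟩).symm.trans (hz' ⟨χ, hχ⟩)]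

lemma IsDeterminingClass.tendsto_nhds [T2Space M] (hS : IsDeterminingClass S) {α : Type*}
    {l : Filter α} [l.IsCountablyGenerated] {u : α → M} {x : M}
    (hu : ∀ χ ∈ S, Tendsto (fun a => χ (u a)) l (𝓝 (χ x))) : Tendsto u l (𝓝 x) := by
  rcases l.eq_or_neBot with rfl | _
  · exact tendsto_bot
  obtain ⟨y, hy, hxy⟩ := hS.exists_tendsto (ψ := fun χ => χ.1 x) (fun χ => hu χ.1 χ.2)
    (hS.exists_ne_zero x)
  rwa [hS.eq_of_forall_eq (x := x) (y := y) fun χ hχ => hxy ⟨χ, hχ⟩]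

/-- Characters in a determining class are continuous: along a convergent sequence the characters
converge jointly along a subsequence, by compactness of `[0,1]^S`; the limit is not zero because
the sequence does not escape to infinity, so it is the value at the limit point. -/
lemma IsDeterminingClass.continuous [T2Space M] [LocallyCompactSpace M]
    [SecondCountableTopology M] (hS : IsDeterminingClass S) {χ : M → ℝ} (hχ : χ ∈ S) :
    Continuous χ := by
  have := hS.countable.to_subtype
  refine continuous_iff_continuousAt.2 fun x => tendsto_of_subseq_tendsto fun ns hns => ?_
  have hK : IsCompact (Set.univ.pi fun _ : S => Set.Icc (0 : ℝ) 1) :=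
    isCompact_univ_pi fun _ => isCompact_Icc
  obtain ⟨ψ, -, φ, hφ, hlim⟩ := hK.tendsto_subseq (x := fun n (χ : S) => χ.1 (ns n))
    fun n χ _ => ⟨(hS.isCharacter _ χ.2).nonneg _, (hS.isCharacter _ χ.2).le_one _⟩
  have hlim' : ∀ χ : S, Tendsto (fun n => χ.1 (ns (φ n))) atTop (𝓝 (ψ χ)) :=
    fun χ => (tendsto_pi_nhds.1 hlim) χ
  have hconv : Tendsto (fun n => ns (φ n)) atTop (𝓝 x) := hns.comp hφ.tendsto_atTop
  have hψ : ∃ χ, ψ χ ≠ 0 := by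
    by_contra! h0
    have hc : Tendsto (fun n => ns (φ n)) atTop (cocompact M) :=
      (hS.tendsto_zero_iff _).1 fun χ hχ => by simpa [h0] using hlim' ⟨χ, hχ⟩
    obtain ⟨K, hKc, hKx⟩ := exists_compact_mem_nhds x
    obtain ⟨n, hn, hn'⟩ := ((hconv.eventually hKx).and
      (hc.eventually hKc.compl_mem_cocompact)).exists
    exact hn' hn
  obtain ⟨y, hy, hψy⟩ := hS.tendsto_of_ne_zero _ ψ hlim' hψ
  have hxy := tendsto_nhds_unique hconv hy
  refine ⟨φ, ?_⟩
  have := hlim' ⟨χ, hχ⟩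
  rwa [hψy, ← hxy] at this

/-- The evaluation map into the nonzero functions on `S` is a closed embedding, and the nonzero
functions form an open subset of the Polish space `S → ℝ`. -/
lemma IsDeterminingClass.polishSpace [T2Space M] [LocallyCompactSpace M]
    [SecondCountableTopology M] (hS : IsDeterminingClass S) : PolishSpace M := by
  have := hS.countable.to_subtype
  have hU : IsOpen {ψ : S → ℝ | ψ ≠ 0} := isOpen_ne
  have := hU.polishSpace
  let Φ : M → {ψ : S → ℝ | ψ ≠ 0} := fun x => ⟨fun χ => χ.1 x, fun h => by
    obtain ⟨χ, hχ⟩ := hS.exists_ne_zero x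
    exact hχ (congrFun h χ)⟩
  have hcont : Continuous Φ :=
    Continuous.subtype_mk (continuous_pi fun χ => hS.continuous χ.2) _
  have happ : ∀ χ : S, Continuous fun ψ : {ψ : S → ℝ | ψ ≠ 0} => ψ.1 χ :=
    fun χ => (continuous_apply χ).comp continuous_subtype_val
  have hinj : Function.Injective Φ := fun x y h =>
    hS.eq_of_forall_eq fun χ hχ => congrFun (congrArg Subtype.val h) ⟨χ, hχ⟩
  have hind : IsInducing Φ := by
    refine isInducing_iff_nhds.2 fun x => le_antisymm (hcont.tendsto x).le_comap ?_
    refine hS.tendsto_nhds (l := comap Φ (𝓝 (Φ x))) (u := id) fun χ hχ => ?_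
    exact ((happ ⟨χ, hχ⟩).tendsto (Φ x)).comp tendsto_comap
  have hclosed : IsClosed (Set.range Φ) := by
    refine IsSeqClosed.isClosed fun u ψ hu hψ => ?_
    choose x hx using hu
    obtain ⟨y, -, hy⟩ := hS.tendsto_of_ne_zero x ψ.1
      (fun χ => by
        refine (((happ χ).tendsto ψ).comp hψ).congr fun n => ?_
        simp [← hx, Φ])
      (Function.ne_iff.1 ψ.2)
    exact ⟨y, Subtype.ext (funext fun χ => (hy χ).symm)⟩
  exact IsClosedEmbedding.polishSpace ⟨⟨hind, hinj⟩, hclosed⟩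

/-- A random element of `M` is almost everywhere measurable if all its characters are. -/
lemma IsDeterminingClass.aemeasurable [T2Space M] [LocallyCompactSpace M]
    [SecondCountableTopology M] [BorelSpace M] (hS : IsDeterminingClass S)
    {Ω : Type*} [MeasurableSpace Ω] {P : Measure Ω} {X : Ω → M}
    (h : ∀ χ ∈ S, AEMeasurable (fun ω => χ (X ω)) P) : AEMeasurable X P := by
  have := hS.countable.to_subtype
  have := hS.polishSpace
  have hΦ : MeasurableEmbedding (fun x (χ : S) => χ.1 x) :=
    Continuous.measurableEmbedding (continuous_pi fun χ => hS.continuous χ.2)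
      fun x y h => hS.eq_of_forall_eq fun χ hχ => congrFun h ⟨χ, hχ⟩
  rw [← hΦ.aemeasurable_comp_iff]
  exact aemeasurable_pi_lambda _ fun χ => h χ.1 χ.2

end Topology

/-! ### Laws are determined by multiplicative separating families -/

/-- A multiplicative family of continuous `[0,1]`-valued functions separating the points of a
Polish space determines probability measures. -/
lemma ext_of_forall_lintegral_eq_of_mul_mem {E : Type*} [TopologicalSpace E] [PolishSpace E]
    [MeasurableSpace E] [BorelSpace E] {μ μ' : Measure E} [IsProbabilityMeasure μ]
    [IsProbabilityMeasure μ'] {T : Set (E → ℝ)} (hcont : ∀ g ∈ T, Continuous g)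
    (h0 : ∀ g ∈ T, ∀ x, 0 ≤ g x) (h1 : ∀ g ∈ T, ∀ x, g x ≤ 1)
    (hmul : ∀ g ∈ T, ∀ h ∈ T, g * h ∈ T) (hsep : ∀ x y, x ≠ y → ∃ g ∈ T, g x ≠ g y)
    (heq : ∀ g ∈ T, ∫⁻ x, ENNReal.ofReal (g x) ∂μ = ∫⁻ x, ENNReal.ofReal (g x) ∂μ') :
    μ = μ' := by
  let T' : Set (BoundedContinuousFunction E ℝ) := {g | (g : E → ℝ) ∈ T}
  have hlift : ∀ g ∈ T, ∃ g' ∈ T', (g' : E → ℝ) = g := fun g hg =>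
    ⟨BoundedContinuousFunction.ofNormedAddCommGroup g (hcont g hg) 1 fun x => by
      rw [Real.norm_eq_abs, abs_le]
      exact ⟨by linarith [h0 g hg x], h1 g hg x⟩, hg, rfl⟩
  have hT' : ∀ g ∈ T', ∫ x, g x ∂μ = ∫ x, g x ∂μ' := fun g hg => by
    rw [integral_eq_lintegral_of_nonneg_ae (ae_of_all _ (h0 _ hg))
        g.continuous.aestronglyMeasurable,
      integral_eq_lintegral_of_nonneg_ae (ae_of_all _ (h0 _ hg))
        g.continuous.aestronglyMeasurable, heq _ hg]
  let A : StarSubalgebra ℝ (BoundedContinuousFunction E ℝ) := StarAlgebra.adjoin ℝ T'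
  -- as `T'` is closed under products, the algebra it generates is the span of `T'` and `1`
  have hA : ∀ g ∈ A, g ∈ Submodule.span ℝ (insert 1 T') := by
    intro g hg
    have hstar : star T' = T' := by
      ext f
      rw [Set.mem_star]
      have : star f = f := by ext x; simp
      rw [this]
    have hg' : g ∈ Algebra.adjoin ℝ (T' ∪ star T') := hg
    rw [hstar, Set.union_self, ← Subalgebra.mem_toSubmodule, Algebra.adjoin_eq_span] at hg'
    refine Submodule.span_mono ?_ hg'
    intro f hf
    induction hf using Submonoid.closure_induction with
    | mem x hx => exact Or.inr hx
    | one => exact Or.inl rfl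
    | mul x y _ _ hx hy =>
      rcases hx with rfl | hx
      · simpa using hy
      rcases hy with rfl | hy
      · simpa using Or.inr hx
      exact Or.inr (by simpa [T'] using hmul _ hx _ hy)
  refine ext_of_forall_mem_subalgebra_integral_eq_of_polish (𝕜 := ℝ) (A := A) ?_ ?_
  · intro x y hxy
    obtain ⟨g, hg, hgxy⟩ := hsep x y hxy
    obtain ⟨g', hg', rfl⟩ := hlift g hg
    exact ⟨g', ⟨g'.toContinuousMap, ⟨g', StarAlgebra.subset_adjoin ℝ T' hg', rfl⟩, rfl⟩, hgxy⟩
  · intro g hg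
    have hint : ∀ (f : BoundedContinuousFunction E ℝ) (ρ : Measure E) [IsProbabilityMeasure ρ],
        Integrable f ρ := fun f ρ _ => f.integrable ρ
    have hspan := hA g hg
    clear hg
    induction hspan using Submodule.span_induction with
    | mem x hx =>
      rcases hx with rfl | hx
      · simp
      · exact hT' x hx
    | zero => simp
    | add x y _ _ hx hy =>
      simp only [BoundedContinuousFunction.coe_add, Pi.add_apply]
      rw [integral_add (hint _ _) (hint _ _), integral_add (hint _ _) (hint _ _), hx, hy]
    | smul a x _ hx =>
      simp only [BoundedContinuousFunction.coe_smul, integral_smul, hx]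

section Laws

variable {M : Type*} [AddCommMonoid M] [TopologicalSpace M] [MeasurableSpace M] [BorelSpace M]
  [LocallyCompactSpace M] [SecondCountableTopology M] [T2Space M] {S : Set (M → ℝ)}

lemma IsDeterminingClass.measure_ext (hS : IsDeterminingClass S) {μ μ' : Measure M}
    [IsProbabilityMeasure μ] [IsProbabilityMeasure μ']
    (h : ∀ χ ∈ S, ∫⁻ x, ENNReal.ofReal (χ x) ∂μ = ∫⁻ x, ENNReal.ofReal (χ x) ∂μ') : μ = μ' := by
  have := hS.polishSpace
  refine ext_of_forall_lintegral_eq_of_mul_mem (fun χ hχ => hS.continuous hχ)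
    (fun χ hχ => (hS.isCharacter χ hχ).nonneg) (fun χ hχ => (hS.isCharacter χ hχ).le_one)
    hS.mul_mem (fun x y hxy => ?_) h
  by_contra! h
  exact hxy (hS.eq_of_forall_eq h)

/-- The law of a random vector in `M` is determined by the products of characters of its
coordinates. The trivial character is adjoined to `S`, so that coordinates can be left out. -/
lemma IsDeterminingClass.measure_pi_ext (hS : IsDeterminingClass S) {ι : Type*} [Fintype ι]
    {μ μ' : Measure (ι → M)} [IsProbabilityMeasure μ] [IsProbabilityMeasure μ']
    (h : ∀ χ : ι → M → ℝ, (∀ k, χ k ∈ insert 1 S) →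
      ∫⁻ x, ∏ k, ENNReal.ofReal (χ k (x k)) ∂μ = ∫⁻ x, ∏ k, ENNReal.ofReal (χ k (x k)) ∂μ') :
    μ = μ' := by
  classical
  have := hS.polishSpace
  have hc : ∀ χ ∈ insert 1 S, Continuous χ ∧ (∀ x, 0 ≤ χ x) ∧ ∀ x, χ x ≤ 1 := by
    rintro χ (rfl | hχ)
    · exact ⟨continuous_const, fun _ => zero_le_one, fun _ => le_rfl⟩
    · exact ⟨hS.continuous hχ, (hS.isCharacter χ hχ).nonneg, (hS.isCharacter χ hχ).le_one⟩
  refine ext_of_forall_lintegral_eq_of_mul_mem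
    (T := {g | ∃ χ : ι → M → ℝ, (∀ k, χ k ∈ insert 1 S) ∧ g = fun x => ∏ k, χ k (x k)})
    ?_ ?_ ?_ ?_ ?_ ?_
  · rintro _ ⟨χ, hχ, rfl⟩
    exact continuous_finsetProd _ fun k _ => (hc _ (hχ k)).1.comp (continuous_apply k)
  · rintro _ ⟨χ, hχ, rfl⟩ x
    exact Finset.prod_nonneg fun k _ => (hc _ (hχ k)).2.1 _
  · rintro _ ⟨χ, hχ, rfl⟩ x
    exact Finset.prod_le_one (fun k _ => (hc _ (hχ k)).2.1 _) fun k _ => (hc _ (hχ k)).2.2 _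
  · rintro _ ⟨χ, hχ, rfl⟩ _ ⟨χ', hχ', rfl⟩
    refine ⟨fun k => χ k * χ' k, fun k => ?_, ?_⟩
    · rcases hχ k with h | h
      · simpa [h] using hχ' k
      rcases hχ' k with h' | h'
      · simpa [h'] using Or.inr h
      exact Or.inr (hS.mul_mem _ h _ h')
    · ext x
      simp [Finset.prod_mul_distrib]
  · intro x y hxy
    obtain ⟨k, hk⟩ := Function.ne_iff.1 hxy
    obtain ⟨χ, hχ, hne⟩ : ∃ χ ∈ S, χ (x k) ≠ χ (y k) := by
      by_contra! h
      exact hk (hS.eq_of_forall_eq h)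
    refine ⟨_, ⟨Pi.mulSingle k χ, fun j => ?_, rfl⟩, ?_⟩
    · rcases eq_or_ne j k with rfl | hj
      · simpa using Or.inr hχ
      · simp [hj]
    · have : ∀ z : ι → M, ∏ j, (Pi.mulSingle k χ : ι → M → ℝ) j (z j) = χ (z k) := fun z => by
        rw [Finset.prod_eq_single k (fun j _ hj => by simp [hj]) (by simp)]
        simp
      simpa [this] using hne
  · rintro _ ⟨χ, hχ, rfl⟩
    simpa [ENNReal.ofReal_prod_of_nonneg fun k _ => (hc _ (hχ k)).2.1 _] using h χ hχ

end Laws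

/-! ### The exponential `a ↦ exp (-a)` on `[0, ∞]` -/

/-- The map `a ↦ exp (-a)` from `[0, ∞]` to `[0, 1]`, with `exp (-∞) = 0`. -/
noncomputable def expNeg (a : ℝ≥0∞) : ℝ≥0∞ := EReal.exp (-(a : EReal))

/-- The inverse `c ↦ -log c` of `expNeg`, for `c ≤ 1`; it takes the value `∞` at `0`. -/
noncomputable def negLog (c : ℝ≥0∞) : ℝ≥0∞ := (-ENNReal.log c).toENNReal

@[simp] lemma expNeg_zero : expNeg 0 = 1 := by simp [expNeg]

lemma expNeg_add (a b : ℝ≥0∞) : expNeg (a + b) = expNeg a * expNeg b := by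
  rw [expNeg, EReal.coe_ennreal_add, EReal.neg_add (Or.inl (EReal.coe_ennreal_ne_bot a))
    (Or.inr (EReal.coe_ennreal_ne_bot b)), sub_eq_add_neg, EReal.exp_add]
  rfl

lemma expNeg_sum {ι : Type*} (s : Finset ι) (a : ι → ℝ≥0∞) :
    expNeg (∑ i ∈ s, a i) = ∏ i ∈ s, expNeg (a i) := by
  classical
  induction s using Finset.induction_on with
  | empty => simp
  | insert i s hi ih => rw [Finset.sum_insert hi, Finset.prod_insert hi, expNeg_add, ih]

lemma expNeg_mul_natCast (a : ℝ≥0∞) (k : ℕ) : expNeg (a * k) = expNeg a ^ k := by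
  have := expNeg_sum (Finset.range k) fun _ => a
  simpa [mul_comm] using this

lemma continuous_expNeg : Continuous expNeg :=
  ENNReal.continuous_exp.comp (continuous_neg.comp continuous_coe_ennreal_ereal)

lemma measurable_expNeg : Measurable expNeg := continuous_expNeg.measurable

lemma antitone_expNeg : Antitone expNeg := fun _ _ h =>
  EReal.exp_monotone (EReal.neg_le_neg_iff.2 (EReal.coe_ennreal_le_coe_ennreal_iff.2 h))

lemma expNeg_le_one (a : ℝ≥0∞) : expNeg a ≤ 1 := expNeg_zero ▸ antitone_expNeg zero_le

lemma expNeg_eq_one_iff {a : ℝ≥0∞} : expNeg a = 1 ↔ a = 0 := by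
  refine ⟨fun h => ?_, fun h => by simp [h]⟩
  have h1 : -(a : EReal) = 0 := EReal.exp_strictMono.injective (by simpa [expNeg] using h)
  simpa using h1

lemma expNeg_ofReal {r : ℝ} (hr : 0 ≤ r) :
    expNeg (ENNReal.ofReal r) = ENNReal.ofReal (Real.exp (-r)) := by
  rw [expNeg, EReal.coe_ennreal_ofReal, max_eq_left hr, ← EReal.coe_neg, EReal.exp_coe]

lemma measurable_negLog : Measurable negLog :=
  measurable_ereal_toENNReal.comp (measurable_neg.comp ENNReal.measurable_log)

lemma expNeg_negLog {c : ℝ≥0∞} (hc : c ≤ 1) : expNeg (negLog c) = c := by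
  have h : 0 ≤ -ENNReal.log c := by simpa using hc
  rw [expNeg, negLog, EReal.coe_toENNReal h, neg_neg, ENNReal.exp_log]

/-! ### The Poisson distribution -/

lemma lintegral_poissonMeasure (r : ℝ≥0) (f : ℕ → ℝ≥0∞) :
    ∫⁻ k, f k ∂(poissonMeasure r) =
      ∑' k : ℕ, ENNReal.ofReal (Real.exp (-r) * r ^ k / k.factorial) * f k := by
  rw [poissonMeasure, lintegral_sum_measure]
  congr with k
  rw [lintegral_smul_measure, lintegral_dirac, smul_eq_mul]

lemma lintegral_natCast_poissonMeasure (r : ℝ≥0) :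
    ∫⁻ k : ℕ, (k : ℝ≥0∞) ∂(poissonMeasure r) = r := by
  rw [lintegral_poissonMeasure, tsum_eq_zero_add' ENNReal.summable]
  have h : ∀ k : ℕ, ENNReal.ofReal (Real.exp (-r) * r ^ (k + 1) / (k + 1).factorial) *
      ((k + 1 : ℕ) : ℝ≥0∞) =
      r * (ENNReal.ofReal (Real.exp (-r) * r ^ k / k.factorial)) := fun k => by
    rw [← ENNReal.ofReal_natCast, ← ENNReal.ofReal_mul (by positivity),
      ← ENNReal.ofReal_coe_nnreal, ← ENNReal.ofReal_mul (by positivity), Nat.factorial_succ]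
    congr 1
    push_cast
    field_simp
    ring
  simp only [h, ENNReal.tsum_mul_left]
  rw [← ENNReal.ofReal_tsum_of_nonneg (fun k => by positivity)
    (hasSum_one_poissonMeasure r).summable, (hasSum_one_poissonMeasure r).tsum_eq]
  simp

/-- The Laplace transform of the Poisson distribution. -/
lemma lintegral_expNeg_poissonMeasure (r : ℝ≥0) (a : ℝ≥0∞) :
    ∫⁻ k : ℕ, expNeg (a * k) ∂(poissonMeasure r) = expNeg ((1 - expNeg a) * r) := by
  -- with `q = exp (-a)` this is the exponential series `∑ exp (-r) (r q) ^ k / k!`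
  obtain ⟨q, hq⟩ : ∃ q : ℝ≥0, expNeg a = q :=
    ⟨(expNeg a).toNNReal,
      (ENNReal.coe_toNNReal ((expNeg_le_one a).trans_lt ENNReal.one_lt_top).ne).symm⟩
  have hq1 : q ≤ 1 := by exact_mod_cast hq ▸ expNeg_le_one a
  have hrhs : (1 - (q : ℝ≥0∞)) * r = ENNReal.ofReal ((1 - q) * r) := by
    rw [ENNReal.ofReal_mul (sub_nonneg.2 (by exact_mod_cast hq1)),
      ENNReal.ofReal_sub _ q.coe_nonneg]
    simp
  have h : ∀ k : ℕ, ENNReal.ofReal (Real.exp (-r) * r ^ k / k.factorial) * (q : ℝ≥0∞) ^ k =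
      ENNReal.ofReal (Real.exp (-r) * ((r * q : ℝ) ^ k / k.factorial)) := fun k => by
    rw [← ENNReal.ofReal_coe_nnreal, ← ENNReal.ofReal_pow q.coe_nonneg,
      ← ENNReal.ofReal_mul (by positivity)]
    congr 1
    ring
  have hs : HasSum (fun k : ℕ => Real.exp (-r) * ((r * q : ℝ) ^ k / k.factorial))
      (Real.exp (-r) * Real.exp (r * q)) := by
    have := NormedSpace.expSeries_div_hasSum_exp (r * q : ℝ)
    rw [← Real.exp_eq_exp_ℝ] at this
    exact this.mul_left _
  simp only [lintegral_poissonMeasure, expNeg_mul_natCast, hq, h]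
  rw [← ENNReal.ofReal_tsum_of_nonneg (fun k => by positivity) hs.summable, hs.tsum_eq, hrhs,
    expNeg_ofReal (mul_nonneg (sub_nonneg.2 (by exact_mod_cast hq1)) r.coe_nonneg), ← Real.exp_add]
  congr 2
  ring

/-! ### Poisson point processes -/

section PointProcess

variable {Ω E : Type*} [MeasurableSpace Ω] [MeasurableSpace E] {P : Measure Ω}
  {N : Ω → Measure E} {Λ : Measure E}

lemma IsPoissonPointProcess.measurable_apply (hN : IsPoissonPointProcess P N Λ) {A : Set E}
    (hA : MeasurableSet A) : Measurable fun ω => N ω A :=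
  (Measure.measurable_coe hA).comp hN.measurable

lemma IsPoissonPointProcess.lintegral_comp_apply (hN : IsPoissonPointProcess P N Λ) {A : Set E}
    (hA : MeasurableSet A) (hΛ : Λ A ≠ ∞) {g : ℝ≥0∞ → ℝ≥0∞} (hg : Measurable g) :
    ∫⁻ ω, g (N ω A) ∂P = ∫⁻ k : ℕ, g k ∂(poissonMeasure (Λ A).toNNReal) := by
  rw [← lintegral_map hg (hN.measurable_apply hA), hN.map_eq A hA hΛ,
    lintegral_map hg .of_discrete]

/-- The intensity is the mean measure of the process. -/
lemma IsPoissonPointProcess.bind_eq [IsProbabilityMeasure P]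
    (hN : IsPoissonPointProcess P N Λ) : P.bind N = Λ := by
  ext A hA
  rw [Measure.bind_apply hA hN.measurable.aemeasurable]
  by_cases hΛ : Λ A = ∞
  · rw [lintegral_congr_ae (hN.eq_top A hA hΛ), hΛ]
    simp
  · have := hN.lintegral_comp_apply hA hΛ measurable_id
    simp only [id] at this
    rw [this]
    simp [lintegral_natCast_poissonMeasure, ENNReal.coe_toNNReal hΛ]

/-- Campbell's formula. -/
lemma IsPoissonPointProcess.lintegral_lintegral [IsProbabilityMeasure P]
    (hN : IsPoissonPointProcess P N Λ)
    {f : E → ℝ≥0∞} (hf : Measurable f) : ∫⁻ ω, ∫⁻ x, f x ∂N ω ∂P = ∫⁻ x, f x ∂Λ := by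
  rw [← hN.bind_eq, Measure.lintegral_bind hN.measurable.aemeasurable hf.aemeasurable]

lemma IsPoissonPointProcess.lintegral_expNeg_apply [IsProbabilityMeasure P]
    (hN : IsPoissonPointProcess P N Λ) {A : Set E}
    (hA : MeasurableSet A) (a : ℝ≥0∞) :
    ∫⁻ ω, expNeg (a * N ω A) ∂P = expNeg ((1 - expNeg a) * Λ A) := by
  by_cases hΛ : Λ A = ∞
  · -- both sides are `0`, except for `a = 0`, where the convention `0 * ∞ = 0` makes them `1`
    have h : ∀ᵐ ω ∂P, expNeg (a * N ω A) = expNeg (a * ∞) := by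
      filter_upwards [hN.eq_top A hA hΛ] with ω hω
      rw [hω]
    rw [lintegral_congr_ae h, hΛ]
    rcases eq_or_ne a 0 with rfl | ha
    · simp
    · have : 1 - expNeg a ≠ 0 := fun h0 => ha <| expNeg_eq_one_iff.1 <|
        le_antisymm (expNeg_le_one a) (tsub_eq_zero_iff_le.1 h0)
      simp [ENNReal.mul_top, ha, this]
  · rw [hN.lintegral_comp_apply hA hΛ (g := fun c => expNeg (a * c))
        (measurable_expNeg.comp (measurable_const_mul a)), lintegral_expNeg_poissonMeasure,
      ENNReal.coe_toNNReal hΛ]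

/-- The Laplace functional at a simple function: the level sets are disjoint, so their numbers of
points are independent Poisson variables. -/
lemma IsPoissonPointProcess.lintegral_expNeg_simpleFunc [IsProbabilityMeasure P]
    (hN : IsPoissonPointProcess P N Λ)
    (f : SimpleFunc E ℝ≥0∞) :
    ∫⁻ ω, expNeg (∫⁻ x, f x ∂N ω) ∂P = expNeg (∫⁻ x, 1 - expNeg (f x) ∂Λ) := by
  let e := f.range.equivFin
  have hmeas : ∀ a, MeasurableSet (f ⁻¹' {a}) := f.measurableSet_fiber
  have hind : ProbabilityTheory.iIndepFun (fun (a : f.range) ω => N ω (f ⁻¹' {a.1})) P := by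
    have := hN.iIndepFun _ (fun k => f ⁻¹' {(e.symm k).1}) (fun k => hmeas _) fun j k hjk => by
      refine Set.disjoint_left.2 fun x hj hk => hjk (e.symm.injective (Subtype.ext ?_))
      exact (Set.mem_singleton_iff.1 hj).symm.trans hk
    simpa using this.precomp e.injective
  have hind' := hind.comp (fun (a : f.range) c => expNeg (a.1 * c))
    fun a => measurable_expNeg.comp (measurable_const_mul a.1)
  have hl : ∀ ω, expNeg (∫⁻ x, f x ∂N ω) = ∏ a : f.range, expNeg (a.1 * N ω (f ⁻¹' {a.1})) :=
    fun ω => by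
      rw [SimpleFunc.lintegral_eq_lintegral, SimpleFunc.lintegral, expNeg_sum,
        ← Finset.prod_coe_sort]
  have hr : ∫⁻ x, 1 - expNeg (f x) ∂Λ =
      ∑ a : f.range, (1 - expNeg a.1) * Λ (f ⁻¹' {a.1}) := by
    rw [Finset.sum_coe_sort f.range fun a => (1 - expNeg a) * Λ (f ⁻¹' {a}),
      ← SimpleFunc.map_lintegral (fun a => 1 - expNeg a) f, ← SimpleFunc.lintegral_eq_lintegral]
    rfl
  simp only [hl]
  rw [hr, expNeg_sum]
  simp only [← hN.lintegral_expNeg_apply (hmeas _)]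
  exact lintegral_prod_eq_prod_lintegral_of_indepFun Finset.univ _ hind' fun a =>
    measurable_expNeg.comp ((measurable_const_mul a.1).comp (hN.measurable_apply (hmeas _)))

/-- The Laplace functional of a Poisson point process, by monotone approximation of `f` by simple
functions. -/
lemma IsPoissonPointProcess.lintegral_expNeg [IsProbabilityMeasure P]
    (hN : IsPoissonPointProcess P N Λ)
    {f : E → ℝ≥0∞} (hf : Measurable f) :
    ∫⁻ ω, expNeg (∫⁻ x, f x ∂N ω) ∂P = expNeg (∫⁻ x, 1 - expNeg (f x) ∂Λ) := by
  let g : ℕ → SimpleFunc E ℝ≥0∞ := SimpleFunc.eapprox f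
  have hg : Monotone fun n x => g n x := fun m n h x => SimpleFunc.monotone_eapprox f h x
  have hN' : ∀ n, Measurable fun ω => ∫⁻ x, g n x ∂N ω := fun n =>
    (Measure.measurable_lintegral (g n).measurable).comp hN.measurable
  have h1 : Tendsto (fun n => ∫⁻ ω, expNeg (∫⁻ x, g n x ∂N ω) ∂P) atTop
      (𝓝 (∫⁻ ω, expNeg (∫⁻ x, f x ∂N ω) ∂P)) := by
    refine lintegral_tendsto_of_tendsto_of_antitone
      (fun n => (measurable_expNeg.comp (hN' n)).aemeasurable)
      (ae_of_all _ fun ω m n h => antitone_expNeg (lintegral_mono (hg h))) ?_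
      (ae_of_all _ fun ω => (continuous_expNeg.tendsto _).comp ?_)
    · refine ((lintegral_mono fun ω => expNeg_le_one _).trans_lt ?_).ne
      simp
    · exact lintegral_tendsto_of_tendsto_of_monotone (fun n => (g n).measurable.aemeasurable)
        (ae_of_all _ fun x m n h => hg h x) (ae_of_all _ fun x => SimpleFunc.tendsto_eapprox hf x)
  have h2 : Tendsto (fun n => expNeg (∫⁻ x, 1 - expNeg (g n x) ∂Λ)) atTop
      (𝓝 (expNeg (∫⁻ x, 1 - expNeg (f x) ∂Λ))) := by
    refine (continuous_expNeg.tendsto _).comp ?_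
    refine lintegral_tendsto_of_tendsto_of_monotone
      (fun n => (measurable_const.sub (measurable_expNeg.comp (g n).measurable)).aemeasurable)
      (ae_of_all _ fun x m n h => tsub_le_tsub_left (antitone_expNeg (hg h x)) 1)
      (ae_of_all _ fun x => ?_)
    exact ENNReal.Tendsto.sub tendsto_const_nhds
      ((continuous_expNeg.tendsto _).comp (SimpleFunc.tendsto_eapprox hf x))
      (Or.inl ENNReal.one_ne_top)
  refine tendsto_nhds_unique h1 (h2.congr fun n => ?_)
  exact (hN.lintegral_expNeg_simpleFunc (g n)).symm

end PointProcess

/-! ### Unconditional summability -/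

section Summability

variable {M : Type*} [AddCommMonoid M] [MeasurableSpace M]

lemma IsCharacter.map_sum {χ : M → ℝ} (hχ : IsCharacter χ) {ι : Type*} (s : Finset ι)
    (x : ι → M) : χ (∑ i ∈ s, x i) = ∏ i ∈ s, χ (x i) := by
  classical
  induction s using Finset.induction_on with
  | empty => simp [hχ.map_zero]
  | insert i s hi ih => rw [Finset.sum_insert hi, Finset.prod_insert hi, hχ.map_add, ih]

lemma IsCharacter.one_sub_map_sum_le {χ : M → ℝ} (hχ : IsCharacter χ) {ι : Type*} (s : Finset ι)
    (x : ι → M) : 1 - χ (∑ i ∈ s, x i) ≤ ∑ i ∈ s, (1 - χ (x i)) := by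
  classical
  induction s using Finset.induction_on with
  | empty => simp [hχ.map_zero]
  | insert i s hi ih =>
    rw [Finset.sum_insert hi, Finset.sum_insert hi, hχ.map_add]
    nlinarith [hχ.le_one (x i), hχ.le_one (∑ i ∈ s, x i)]

lemma IsCharacter.antitone_map_sum {χ : M → ℝ} (hχ : IsCharacter χ) {ι : Type*} (x : ι → M) :
    Antitone fun s : Finset ι => χ (∑ i ∈ s, x i) := fun s t hst => by
  classical
  change χ (∑ i ∈ t, x i) ≤ χ (∑ i ∈ s, x i)
  rw [← Finset.sum_sdiff hst, hχ.map_add]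
  exact mul_le_of_le_one_left (hχ.nonneg _) (hχ.le_one _)

variable [TopologicalSpace M]

lemma IsCharacter.one_sub_map_tsum_le {χ : M → ℝ} (hχ : IsCharacter χ) (hc : Continuous χ)
    {ι : Type*} {x : ι → M} (hx : Summable x) (h : Summable fun i => 1 - χ (x i)) :
    1 - χ (∑' i, x i) ≤ ∑' i, (1 - χ (x i)) :=
  le_of_tendsto_of_tendsto (tendsto_const_nhds.sub ((hc.tendsto _).comp hx.hasSum)) h.hasSum
    (Eventually.of_forall fun s => hχ.one_sub_map_sum_le s x)

/-- A continuous character turns a convergent sum into the exponential of a sum in `[0, ∞]`. -/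
lemma IsCharacter.ofReal_map_tsum {χ : M → ℝ} (hχ : IsCharacter χ) (hc : Continuous χ)
    {ι : Type*} {x : ι → M} (hx : Summable x) :
    ENNReal.ofReal (χ (∑' i, x i)) = expNeg (∑' i, negLog (ENNReal.ofReal (χ (x i)))) := by
  have h1 : Tendsto (fun s : Finset ι => ENNReal.ofReal (χ (∑ i ∈ s, x i))) atTop
      (𝓝 (ENNReal.ofReal (χ (∑' i, x i)))) :=
    ((ENNReal.continuous_ofReal.comp hc).tendsto _).comp hx.hasSum
  have h2 := (continuous_expNeg.tendsto _).comp
    (ENNReal.summable (f := fun i => negLog (ENNReal.ofReal (χ (x i))))).hasSum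
  refine tendsto_nhds_unique h1 (h2.congr fun s => ?_)
  rw [Function.comp_apply, expNeg_sum, hχ.map_sum,
    ENNReal.ofReal_prod_of_nonneg fun _ _ => hχ.nonneg _]
  refine Finset.prod_congr rfl fun i _ => expNeg_negLog ?_
  simpa using hχ.le_one (x i)

/-- If one character keeps the partial sums away from infinity, the family is summable: every
character decreases along the partial sums, and the limits do not all vanish. -/
lemma IsDeterminingClass.summable_of_sum_le [T2Space M] {S : Set (M → ℝ)}
    (hS : IsDeterminingClass S) {ι : Type*} [Countable ι] {x : ι → M} {χ : M → ℝ} (hχ : χ ∈ S)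
    {c : ℝ} (hc : c < 1) (h : ∀ s : Finset ι, ∑ i ∈ s, (1 - χ (x i)) ≤ c) : Summable x := by
  have hlim : ∀ χ : S, Tendsto (fun s : Finset ι => χ.1 (∑ i ∈ s, x i)) atTop
      (𝓝 (⨅ s : Finset ι, χ.1 (∑ i ∈ s, x i))) := fun χ =>
    tendsto_atTop_ciInf ((hS.isCharacter _ χ.2).antitone_map_sum x)
      ⟨0, by rintro _ ⟨s, rfl⟩; exact (hS.isCharacter _ χ.2).nonneg _⟩
  obtain ⟨y, hy, -⟩ := hS.exists_tendsto hlim ⟨⟨χ, hχ⟩, by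
    refine (lt_of_lt_of_le (sub_pos.2 hc) (le_ciInf fun s => ?_)).ne'
    have := (hS.isCharacter _ hχ).one_sub_map_sum_le s x
    linarith [h s]⟩
  exact ⟨y, hy⟩

/-- All but finitely many terms form a family as in `summable_of_sum_le`. -/
lemma IsDeterminingClass.summable [T2Space M] [ContinuousAdd M] {S : Set (M → ℝ)}
    (hS : IsDeterminingClass S) {ι : Type*} [Countable ι] {x : ι → M}
    (h : ∀ χ ∈ S, Summable fun i => 1 - χ (x i)) : Summable x := by
  obtain ⟨χ, hχ⟩ := hS.nonempty
  have hnn : ∀ i, 0 ≤ 1 - χ (x i) := fun i => sub_nonneg.2 ((hS.isCharacter χ hχ).le_one _)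
  obtain ⟨F, hF⟩ := (summable_iff_vanishing_norm.1 (h χ hχ)) (1 / 2) (by norm_num)
  have h1 : Summable (x ∘ ((↑) : ((F : Set ι)ᶜ : Set ι) → ι)) := by
    refine hS.summable_of_sum_le hχ (c := 1 / 2) (by norm_num) fun s => ?_
    have h2 := hF (s.map (Function.Embedding.subtype _)) (by
      rw [Finset.disjoint_left]
      intro i hi
      obtain ⟨j, -, rfl⟩ := Finset.mem_map.1 hi
      exact j.2)
    rw [Finset.sum_map, Real.norm_of_nonneg (Finset.sum_nonneg fun _ _ => hnn _)] at h2
    exact h2.le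
  exact (F.hasSum x).summable.add_compl h1

end Summability

/-! ### Sums over the atoms -/

section Atoms

variable {M : Type*} {S : Set (M → ℝ)} {J : Set ℕ} {ξ : ℕ → Set.Ioi (0 : ℝ) × M} {B C : Set ℝ}

/-- The atoms up to any finite time have summable deviations `1 - χ` from the neutral element, for
all characters `χ ∈ S`. -/
def LocallySummable (S : Set (M → ℝ)) (J : Set ℕ) (ξ : ℕ → Set.Ioi (0 : ℝ) × M) : Prop :=
  ∀ χ ∈ S, ∀ n : ℕ, Summable fun i : atomsIn J ξ (Set.Iic (n : ℝ)) => 1 - χ (ξ i).2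

lemma atomsIn_mono (h : B ⊆ C) : atomsIn J ξ B ⊆ atomsIn J ξ C := fun _ hi => ⟨hi.1, h hi.2⟩

lemma atomsIn_union : atomsIn J ξ (B ∪ C) = atomsIn J ξ B ∪ atomsIn J ξ C :=
  Set.ext fun _ => and_or_left

lemma disjoint_atomsIn (h : Disjoint B C) : Disjoint (atomsIn J ξ B) (atomsIn J ξ C) :=
  Set.disjoint_left.2 fun _ hB hC => Set.disjoint_left.1 h hB.2 hC.2

lemma atomSum_Iic_zero [AddCommMonoid M] [TopologicalSpace M] :
    atomSum J ξ (Set.Iic (0 : ℝ)) = 0 := by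
  have : IsEmpty (atomsIn J ξ (Set.Iic (0 : ℝ))) :=
    ⟨fun i => not_lt.2 i.2.2 (Set.mem_Ioi.1 (ξ i).1.2)⟩
  exact tsum_empty

lemma LocallySummable.summable_one_sub (h : LocallySummable S J ξ) (hB : BddAbove B)
    {χ : M → ℝ} (hχ : χ ∈ S) : Summable fun i : atomsIn J ξ B => 1 - χ (ξ i).2 := by
  obtain ⟨b, hb⟩ := hB
  obtain ⟨n, hn⟩ := exists_nat_ge b
  have hsub : atomsIn J ξ B ⊆ atomsIn J ξ (Set.Iic (n : ℝ)) :=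
    atomsIn_mono fun x hx => (hb hx).trans hn
  have h1 := (h χ hχ n).comp_injective (i := Set.inclusion hsub) (Set.inclusion_injective hsub)
  exact h1

variable [AddCommMonoid M] [TopologicalSpace M] [MeasurableSpace M]

lemma LocallySummable.atomSummable [T2Space M] [ContinuousAdd M] (hS : IsDeterminingClass S)
    (h : LocallySummable S J ξ) (hB : BddAbove B) : AtomSummable J ξ B :=
  hS.summable fun _ hχ => h.summable_one_sub hB hχ

lemma LocallySummable.atomSum_union [T2Space M] [ContinuousAdd M] (hS : IsDeterminingClass S)
    (h : LocallySummable S J ξ) (hB : BddAbove B) (hC : BddAbove C) (hBC : Disjoint B C) :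
    atomSum J ξ (B ∪ C) = atomSum J ξ B + atomSum J ξ C := by
  unfold atomSum
  rw [atomsIn_union]
  exact Summable.tsum_union_disjoint (f := fun i => (ξ i).2) (disjoint_atomsIn hBC)
    (h.atomSummable hS hB) (h.atomSummable hS hC)

lemma LocallySummable.atomSum_Iic_eq_add [T2Space M] [ContinuousAdd M]
    (hS : IsDeterminingClass S) (h : LocallySummable S J ξ) {s t : ℝ} (hst : s ≤ t) :
    atomSum J ξ (Set.Iic t) = atomSum J ξ (Set.Iic s) + atomSum J ξ (Set.Ioc s t) := by
  rw [← h.atomSum_union hS bddAbove_Iic bddAbove_Ioc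
    (Set.disjoint_left.2 fun _ h1 h2 => not_lt.2 h1 h2.1), Set.Iic_union_Ioc_eq_Iic hst]

/-- By dominated convergence the deviations of the atoms in `(t, r]` sum up to a quantity that
vanishes as `r` decreases to `t`. -/
lemma LocallySummable.tendsto_atomSum_Ioc [T2Space M] [ContinuousAdd M] [LocallyCompactSpace M]
    [SecondCountableTopology M] (hS : IsDeterminingClass S) (h : LocallySummable S J ξ) (t : ℝ) :
    Tendsto (fun r => atomSum J ξ (Set.Ioc t r)) (𝓝[≥] t) (𝓝 0) := by
  refine hS.tendsto_nhds fun χ hχ => ?_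
  have hχ' := hS.isCharacter χ hχ
  have hnn : ∀ i, 0 ≤ 1 - χ (ξ i).2 := fun i => sub_nonneg.2 (hχ'.le_one _)
  have hle : ∀ r, 1 - χ (atomSum J ξ (Set.Ioc t r)) ≤
      ∑' i, (atomsIn J ξ (Set.Ioc t r)).indicator (fun i => 1 - χ (ξ i).2) i := fun r => by
    rw [← tsum_subtype]
    exact hχ'.one_sub_map_tsum_le (hS.continuous hχ) (h.atomSummable hS bddAbove_Ioc)
      (h.summable_one_sub bddAbove_Ioc hχ)
  have hlim : Tendsto (fun r => ∑' i, (atomsIn J ξ (Set.Ioc t r)).indicator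
      (fun i => 1 - χ (ξ i).2) i) (𝓝[≥] t) (𝓝 (∑' _ : ℕ, (0 : ℝ))) := by
    refine tendsto_tsum_of_dominated_convergence
      (bound := (atomsIn J ξ (Set.Iic (t + 1))).indicator fun i => 1 - χ (ξ i).2)
      (summable_subtype_iff_indicator.1 (h.summable_one_sub bddAbove_Iic hχ)) (fun i => ?_) ?_
    · refine tendsto_const_nhds.congr' ?_
      have : ∀ᶠ r in 𝓝[≥] t, i ∉ atomsIn J ξ (Set.Ioc t r) := by
        rcases le_or_gt ((ξ i).1 : ℝ) t with hi | hi
        · exact Eventually.of_forall fun r hr => not_lt.2 hi hr.2.1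
        · filter_upwards [nhdsWithin_le_nhds (eventually_lt_nhds hi)] with r hr hr'
          exact not_le.2 hr hr'.2.2
      filter_upwards [this] with r hr
      rw [Set.indicator_of_notMem hr]
    · filter_upwards [nhdsWithin_le_nhds (eventually_lt_nhds (lt_add_one t))] with r hr i
      rw [Real.norm_of_nonneg (Set.indicator_nonneg (fun i _ => hnn i) i)]
      exact Set.indicator_le_indicator_of_subset
        (atomsIn_mono fun x hx => hx.2.trans hr.le) (fun i => hnn i) i
  rw [tsum_zero] at hlim
  have h0 := squeeze_zero (fun r => sub_nonneg.2 (hχ'.le_one _)) hle hlim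
  simpa [hχ'.map_zero] using h0.const_sub 1

lemma LocallySummable.continuousWithinAt [T2Space M] [ContinuousAdd M] [LocallyCompactSpace M]
    [SecondCountableTopology M] (hS : IsDeterminingClass S) (h : LocallySummable S J ξ) (t : ℝ) :
    ContinuousWithinAt (fun r : ℝ => atomSum J ξ (Set.Iic r)) (Set.Ici t) t := by
  have h1 := (tendsto_const_nhds (x := atomSum J ξ (Set.Iic t))).add (h.tendsto_atomSum_Ioc hS t)
  rw [add_zero] at h1
  refine h1.congr' ?_
  filter_upwards [self_mem_nhdsWithin] with r hr
  exact (h.atomSum_Iic_eq_add hS hr).symm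

end Atoms

/-! ### Sums over the atoms as integrals against the point process -/

/-- The function `(t, x) ↦ 1_B(t) g(x)` on `(0, ∞) × M`. -/
noncomputable def timeIndicator {M : Type*} (B : Set ℝ) (g : M → ℝ≥0∞)
    (p : Set.Ioi (0 : ℝ) × M) : ℝ≥0∞ :=
  B.indicator (fun _ => g p.2) p.1

section TimeIndicator

variable {M : Type*} {B : Set ℝ} {g : M → ℝ≥0∞}

lemma tsum_timeIndicator (J : Set ℕ) (ξ : ℕ → Set.Ioi (0 : ℝ) × M) :
    ∑' i : J, timeIndicator B g (ξ i) = ∑' i : atomsIn J ξ B, g (ξ i).2 := by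
  classical
  rw [tsum_subtype J fun i => timeIndicator B g (ξ i), tsum_subtype _ fun i => g (ξ i).2]
  congr with i
  by_cases hJ : i ∈ J <;> by_cases hB : ((ξ i).1 : ℝ) ∈ B <;>
    simp [Set.indicator, timeIndicator, atomsIn, hJ, hB]

variable [MeasurableSpace M]

lemma measurable_timeIndicator (hB : MeasurableSet B) (hg : Measurable g) :
    Measurable (timeIndicator B g) :=
  (hg.comp measurable_snd).indicator ((measurable_subtype_coe.comp measurable_fst) hB)

lemma lintegral_timeIndicator_sum_dirac (hB : MeasurableSet B) (hg : Measurable g) (J : Set ℕ)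
    (ξ : ℕ → Set.Ioi (0 : ℝ) × M) :
    ∫⁻ p, timeIndicator B g p ∂(Measure.sum fun i : J => Measure.dirac (ξ i)) =
      ∑' i : atomsIn J ξ B, g (ξ i).2 := by
  rw [lintegral_sum_measure, ← tsum_timeIndicator]
  congr with i
  exact lintegral_dirac' _ (measurable_timeIndicator hB hg)

lemma lintegral_timeIndicator_prod {ν : Measure M} [SFinite ν] (hB : MeasurableSet B)
    (hg : Measurable g) :
    ∫⁻ p, timeIndicator B g p
        ∂(((volume : Measure ℝ).comap (Subtype.val : Set.Ioi (0 : ℝ) → ℝ)).prod ν) =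
      volume (B ∩ Set.Ioi 0) * ∫⁻ x, g x ∂ν := by
  have hB' : MeasurableSet ((↑) ⁻¹' B : Set (Set.Ioi (0 : ℝ))) := measurable_subtype_coe hB
  have h : ∀ p : Set.Ioi (0 : ℝ) × M, timeIndicator B g p =
      ((↑) ⁻¹' B : Set (Set.Ioi (0 : ℝ))).indicator 1 p.1 * g p.2 := fun p => by
    by_cases hp : (p.1 : ℝ) ∈ B <;> simp [timeIndicator, Set.indicator, hp]
  simp only [h]
  rw [lintegral_prod_mul (measurable_one.indicator hB').aemeasurable hg.aemeasurable,
    lintegral_indicator_one hB', (MeasurableEmbedding.subtype_coe measurableSet_Ioi).comap_apply,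
    Subtype.image_preimage_coe, Set.inter_comm]

end TimeIndicator

/-! ### The Laplace transforms of the sums -/

section Laplace

variable {M Ω : Type*} [AddCommMonoid M] [TopologicalSpace M] [MeasurableSpace M]
  {S : Set (M → ℝ)} [MeasurableSpace Ω] {P : Measure Ω} [IsProbabilityMeasure P] {ν : Measure M}
  [SigmaFinite ν] {N : Ω → Measure (Set.Ioi (0 : ℝ) × M)} {J : Ω → Set ℕ}
  {ξ : Ω → ℕ → Set.Ioi (0 : ℝ) × M}

/-- By Campbell's formula the mean of `∑ (1 - χ(xᵢ))` over the atoms up to time `n` is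
`n ∫ (1 - χ) dν < ∞`. -/
lemma IsPoissonPointProcess.ae_locallySummable (hS : IsDeterminingClass S)
    (hν : ∀ χ ∈ S, ∫⁻ x, ENNReal.ofReal (1 - χ x) ∂ν < ∞)
    (hN : IsPoissonPointProcess P N
      (((volume : Measure ℝ).comap (Subtype.val : Set.Ioi (0 : ℝ) → ℝ)).prod ν))
    (hξ : ∀ᵐ ω ∂P, N ω = Measure.sum (fun i : J ω => Measure.dirac (ξ ω i))) :
    ∀ᵐ ω ∂P, LocallySummable S (J ω) (ξ ω) := by
  have h : ∀ χ ∈ S, ∀ n : ℕ, ∀ᵐ ω ∂P,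
      Summable fun i : atomsIn (J ω) (ξ ω) (Set.Iic (n : ℝ)) => 1 - χ (ξ ω i).2 := by
    intro χ hχ n
    have hχ' := hS.isCharacter χ hχ
    have hg : Measurable fun x => ENNReal.ofReal (1 - χ x) :=
      (measurable_const.sub hχ'.measurable).ennreal_ofReal
    have hm := measurable_timeIndicator (measurableSet_Iic (a := (n : ℝ))) hg
    have hfin : ∫⁻ ω, ∫⁻ p, timeIndicator (Set.Iic (n : ℝ))
        (fun x => ENNReal.ofReal (1 - χ x)) p ∂N ω ∂P ≠ ∞ := by
      rw [hN.lintegral_lintegral hm, lintegral_timeIndicator_prod measurableSet_Iic hg]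
      refine ENNReal.mul_ne_top ?_ (hν χ hχ).ne
      rw [Set.inter_comm, Set.Ioi_inter_Iic]
      simp
    filter_upwards [hξ, ae_lt_top ((Measure.measurable_lintegral hm).comp hN.measurable) hfin]
      with ω hω hω'
    rw [Function.comp_apply, hω, lintegral_timeIndicator_sum_dirac measurableSet_Iic hg] at hω'
    refine (ENNReal.summable_toReal hω'.ne).congr fun i => ?_
    rw [ENNReal.toReal_ofReal (sub_nonneg.2 (hχ'.le_one _))]
  filter_upwards [(ae_ball_iff hS.countable).2 fun χ hχ => ae_all_iff.2 (h χ hχ)] with ω hω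
  exact hω

variable [ContinuousAdd M] [T2Space M]

lemma LocallySummable.ofReal_map_atomSum (hS : IsDeterminingClass S)
    {ρ : Measure (Set.Ioi (0 : ℝ) × M)}
    {J : Set ℕ} {ξ : ℕ → Set.Ioi (0 : ℝ) × M} (h : LocallySummable S J ξ)
    (hρ : ρ = Measure.sum (fun i : J => Measure.dirac (ξ i))) {B : Set ℝ} (hB : MeasurableSet B)
    (hB' : BddAbove B) {χ : M → ℝ} (hχ : IsCharacter χ) (hχc : Continuous χ) :
    ENNReal.ofReal (χ (atomSum J ξ B)) =
      expNeg (∫⁻ p, timeIndicator B (fun x => negLog (ENNReal.ofReal (χ x))) p ∂ρ) := by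
  have hg : Measurable fun x => negLog (ENNReal.ofReal (χ x)) :=
    measurable_negLog.comp hχ.measurable.ennreal_ofReal
  rw [hρ, lintegral_timeIndicator_sum_dirac hB hg]
  exact hχ.ofReal_map_tsum hχc (h.atomSummable hS hB')

/-- The joint Laplace transform of the sums over disjoint time sets, from the Laplace functional
of the point process at `∑ₖ 1_{Bₖ}(t) (-log χₖ(x))`. -/
lemma IsPoissonPointProcess.lintegral_prod_map_atomSum (hS : IsDeterminingClass S)
    (hN : IsPoissonPointProcess P N
      (((volume : Measure ℝ).comap (Subtype.val : Set.Ioi (0 : ℝ) → ℝ)).prod ν))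
    (hξ : ∀ᵐ ω ∂P, N ω = Measure.sum (fun i : J ω => Measure.dirac (ξ ω i)))
    (hsum : ∀ᵐ ω ∂P, LocallySummable S (J ω) (ξ ω)) {ι : Type*} [Fintype ι] {B : ι → Set ℝ}
    (hB : ∀ k, MeasurableSet (B k)) (hB' : ∀ k, BddAbove (B k))
    (hdisj : Pairwise fun j k => Disjoint (B j) (B k)) {χ : ι → M → ℝ}
    (hχ : ∀ k, IsCharacter (χ k)) (hχc : ∀ k, Continuous (χ k)) :
    ∫⁻ ω, ∏ k, ENNReal.ofReal (χ k (atomSum (J ω) (ξ ω) (B k))) ∂P =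
      ∏ k, expNeg (volume (B k ∩ Set.Ioi 0) * ∫⁻ x, ENNReal.ofReal (1 - χ k x) ∂ν) := by
  let f : ι → Set.Ioi (0 : ℝ) × M → ℝ≥0∞ := fun k =>
    timeIndicator (B k) fun x => negLog (ENNReal.ofReal (χ k x))
  have hf : ∀ k, Measurable (f k) := fun k => measurable_timeIndicator (hB k)
    (measurable_negLog.comp (hχ k).measurable.ennreal_ofReal)
  have hg : ∀ k, Measurable fun x => ENNReal.ofReal (1 - χ k x) := fun k =>
    (measurable_const.sub (hχ k).measurable).ennreal_ofReal
  have h1 : ∀ᵐ ω ∂P, ∏ k, ENNReal.ofReal (χ k (atomSum (J ω) (ξ ω) (B k))) =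
      expNeg (∫⁻ p, ∑ k, f k p ∂N ω) := by
    filter_upwards [hξ, hsum] with ω hω hω'
    rw [lintegral_finsetSum _ fun k _ => hf k, expNeg_sum]
    exact Finset.prod_congr rfl fun k _ =>
      hω'.ofReal_map_atomSum hS hω (hB k) (hB' k) (hχ k) (hχc k)
  -- at most one of the summands `f k p` is nonzero
  have h2 : ∀ p, 1 - expNeg (∑ k, f k p) =
      ∑ k, timeIndicator (B k) (fun x => ENNReal.ofReal (1 - χ k x)) p := fun p => by
    by_cases hp : ∃ j, (p.1 : ℝ) ∈ B j
    · obtain ⟨j, hj⟩ := hp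
      have hk : ∀ k, k ≠ j → (p.1 : ℝ) ∉ B k := fun k hkj hk =>
        Set.disjoint_left.1 (hdisj hkj) hk hj
      have hz : ∀ (g : ι → M → ℝ≥0∞) (k : ι), k ≠ j → timeIndicator (B k) (g k) p = 0 :=
        fun g k h => Set.indicator_of_notMem (hk k h) _
      rw [Fintype.sum_eq_single j (hz fun k x => negLog (ENNReal.ofReal (χ k x))),
        Fintype.sum_eq_single j (hz fun k x => ENNReal.ofReal (1 - χ k x))]
      simp only [timeIndicator, Set.indicator_of_mem hj]
      rw [expNeg_negLog (by simpa using (hχ j).le_one p.2),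
        ENNReal.ofReal_sub _ ((hχ j).nonneg _), ENNReal.ofReal_one]
    · push Not at hp
      simp [f, timeIndicator, hp]
  rw [lintegral_congr_ae h1, hN.lintegral_expNeg (Finset.measurable_fun_sum _ fun k _ => hf k)]
  simp only [h2]
  rw [lintegral_finsetSum _ fun k _ => measurable_timeIndicator (hB k) (hg k), expNeg_sum]
  exact Finset.prod_congr rfl fun k _ => by rw [lintegral_timeIndicator_prod (hB k) (hg k)]

lemma IsPoissonPointProcess.lintegral_map_atomSum (hS : IsDeterminingClass S)
    (hN : IsPoissonPointProcess P N
      (((volume : Measure ℝ).comap (Subtype.val : Set.Ioi (0 : ℝ) → ℝ)).prod ν))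
    (hξ : ∀ᵐ ω ∂P, N ω = Measure.sum (fun i : J ω => Measure.dirac (ξ ω i)))
    (hsum : ∀ᵐ ω ∂P, LocallySummable S (J ω) (ξ ω)) {B : Set ℝ}
    (hB : MeasurableSet B) (hB' : BddAbove B) {χ : M → ℝ} (hχ : IsCharacter χ)
    (hχc : Continuous χ) :
    ∫⁻ ω, ENNReal.ofReal (χ (atomSum (J ω) (ξ ω) B)) ∂P =
      expNeg (volume (B ∩ Set.Ioi 0) * ∫⁻ x, ENNReal.ofReal (1 - χ x) ∂ν) := by
  simpa using hN.lintegral_prod_map_atomSum hS hξ hsum (ι := Unit) (B := fun _ => B)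
    (fun _ => hB) (fun _ => hB') (fun j k hjk => absurd (Subsingleton.elim j k) hjk)
    (χ := fun _ => χ) (fun _ => hχ) (fun _ => hχc)

end Laplace

/-! ### The laws of the sums -/

section Laws

variable {M Ω : Type*} [AddCommMonoid M] [TopologicalSpace M] [ContinuousAdd M]
  [LocallyCompactSpace M] [SecondCountableTopology M] [T2Space M]
  [MeasurableSpace M] [BorelSpace M] {S : Set (M → ℝ)} [MeasurableSpace Ω] {P : Measure Ω}
  {N : Ω → Measure (Set.Ioi (0 : ℝ) × M)} {J : Ω → Set ℕ} {ξ : Ω → ℕ → Set.Ioi (0 : ℝ) × M}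

lemma aemeasurable_atomSum (hS : IsDeterminingClass S) (hN : Measurable N)
    (hξ : ∀ᵐ ω ∂P, N ω = Measure.sum (fun i : J ω => Measure.dirac (ξ ω i)))
    (hsum : ∀ᵐ ω ∂P, LocallySummable S (J ω) (ξ ω)) {B : Set ℝ} (hB : MeasurableSet B)
    (hB' : BddAbove B) : AEMeasurable (fun ω => atomSum (J ω) (ξ ω) B) P := by
  refine hS.aemeasurable fun χ hχ => ?_
  have hχ' := hS.isCharacter χ hχ
  refine ⟨fun ω => (expNeg (∫⁻ p, timeIndicator B
    (fun x => negLog (ENNReal.ofReal (χ x))) p ∂N ω)).toReal, ?_, ?_⟩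
  · exact (measurable_expNeg.comp ((Measure.measurable_lintegral (measurable_timeIndicator hB
      (measurable_negLog.comp hχ'.measurable.ennreal_ofReal))).comp hN)).ennreal_toReal
  · filter_upwards [hξ, hsum] with ω hω hω'
    rw [← hω'.ofReal_map_atomSum hS hω hB hB' hχ' (hS.continuous hχ),
      ENNReal.toReal_ofReal (hχ'.nonneg _)]

variable [IsProbabilityMeasure P] {ν : Measure M} [SigmaFinite ν]

/-- The law of the sum over a time set depends only on the length of the set. -/
lemma IsPoissonPointProcess.identDistrib_atomSum (hS : IsDeterminingClass S)
    (hN : IsPoissonPointProcess P N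
      (((volume : Measure ℝ).comap (Subtype.val : Set.Ioi (0 : ℝ) → ℝ)).prod ν))
    (hξ : ∀ᵐ ω ∂P, N ω = Measure.sum (fun i : J ω => Measure.dirac (ξ ω i)))
    (hsum : ∀ᵐ ω ∂P, LocallySummable S (J ω) (ξ ω)) {B C : Set ℝ}
    (hB : MeasurableSet B) (hB' : BddAbove B) (hC : MeasurableSet C) (hC' : BddAbove C)
    (hBC : volume (B ∩ Set.Ioi 0) = volume (C ∩ Set.Ioi 0)) :
    IdentDistrib (fun ω => atomSum (J ω) (ξ ω) B) (fun ω => atomSum (J ω) (ξ ω) C) P P := by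
  have hmB := aemeasurable_atomSum hS hN.measurable hξ hsum hB hB'
  have hmC := aemeasurable_atomSum hS hN.measurable hξ hsum hC hC'
  refine ⟨hmB, hmC, ?_⟩
  have := Measure.isProbabilityMeasure_map hmB
  have := Measure.isProbabilityMeasure_map hmC
  refine hS.measure_ext fun χ hχ => ?_
  have hχ' := hS.isCharacter χ hχ
  rw [lintegral_map' hχ'.measurable.ennreal_ofReal.aemeasurable hmB,
    lintegral_map' hχ'.measurable.ennreal_ofReal.aemeasurable hmC,
    hN.lintegral_map_atomSum hS hξ hsum hB hB' hχ' (hS.continuous hχ),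
    hN.lintegral_map_atomSum hS hξ hsum hC hC' hχ' (hS.continuous hχ), hBC]

/-- Sums over disjoint time sets are independent, as their joint Laplace transform factorizes. -/
lemma IsPoissonPointProcess.iIndepFun_atomSum (hS : IsDeterminingClass S)
    (hN : IsPoissonPointProcess P N
      (((volume : Measure ℝ).comap (Subtype.val : Set.Ioi (0 : ℝ) → ℝ)).prod ν))
    (hξ : ∀ᵐ ω ∂P, N ω = Measure.sum (fun i : J ω => Measure.dirac (ξ ω i)))
    (hsum : ∀ᵐ ω ∂P, LocallySummable S (J ω) (ξ ω)) {ι : Type*} [Fintype ι] {B : ι → Set ℝ}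
    (hB : ∀ k, MeasurableSet (B k)) (hB' : ∀ k, BddAbove (B k))
    (hdisj : Pairwise fun j k => Disjoint (B j) (B k)) :
    ProbabilityTheory.iIndepFun (fun k ω => atomSum (J ω) (ξ ω) (B k)) P := by
  have hm := fun k => aemeasurable_atomSum hS hN.measurable hξ hsum (hB k) (hB' k)
  rw [iIndepFun_iff_map_fun_eq_pi_map hm]
  have := Measure.isProbabilityMeasure_map (aemeasurable_pi_lambda _ hm)
  have := fun k => Measure.isProbabilityMeasure_map (hm k)
  refine hS.measure_pi_ext fun χ hχ => ?_
  have hχ' : ∀ k, IsCharacter (χ k) ∧ Continuous (χ k) := fun k => by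
    rcases hχ k with h | h
    · rw [h]
      exact ⟨⟨measurable_const, fun _ => zero_le_one, fun _ => le_rfl, rfl, by simp⟩,
        continuous_const⟩
    · exact ⟨hS.isCharacter _ h, hS.continuous h⟩
  have hχm : ∀ k, Measurable fun x => ENNReal.ofReal (χ k x) :=
    fun k => (hχ' k).1.measurable.ennreal_ofReal
  have hprod : Measurable fun x : ι → M => ∏ k, ENNReal.ofReal (χ k (x k)) :=
    Finset.measurable_fun_prod _ fun k _ => (hχm k).comp (measurable_pi_apply k)
  rw [lintegral_map' hprod.aemeasurable (aemeasurable_pi_lambda _ hm),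
    hN.lintegral_prod_map_atomSum hS hξ hsum hB hB' hdisj (fun k => (hχ' k).1)
      fun k => (hχ' k).2]
  have hpi := lintegral_prod_eq_prod_lintegral_of_indepFun Finset.univ
    (fun k (x : ι → M) => ENNReal.ofReal (χ k (x k)))
    (iIndepFun_pi (μ := fun k => P.map fun ω => atomSum (J ω) (ξ ω) (B k))
      fun k => (hχm k).aemeasurable)
    fun k => (hχm k).comp (measurable_pi_apply k)
  rw [hpi]
  refine Finset.prod_congr rfl fun k _ => ?_
  rw [(measurePreserving_eval (fun k => P.map fun ω => atomSum (J ω) (ξ ω) (B k)) k).lintegral_comp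
    (hχm k), lintegral_map' (hχm k).aemeasurable (hm k),
    hN.lintegral_map_atomSum hS hξ hsum (hB k) (hB' k) (hχ' k).1 (hχ' k).2]

/-- The enlargement carrying the independent copy of `X s` is the product of `(Ω, P)` with the law
of `X s`. -/
lemma IsPoissonPointProcess.isSubordinator_atomSum (hS : IsDeterminingClass S)
    (hN : IsPoissonPointProcess P N
      (((volume : Measure ℝ).comap (Subtype.val : Set.Ioi (0 : ℝ) → ℝ)).prod ν))
    (hξ : ∀ᵐ ω ∂P, N ω = Measure.sum (fun i : J ω => Measure.dirac (ξ ω i)))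
    (hsum : ∀ᵐ ω ∂P, LocallySummable S (J ω) (ξ ω)) :
    IsSubordinator P (fun (t : ℝ≥0) ω => atomSum (J ω) (ξ ω) (Set.Iic t)) where
  aemeasurable t :=
    aemeasurable_atomSum hS hN.measurable hξ hsum measurableSet_Iic bddAbove_Iic
  zero ω := by simpa using atomSum_Iic_zero
  rightContinuous := by
    filter_upwards [hsum] with ω hω t
    exact (hω.continuousWithinAt hS t).comp NNReal.continuous_coe.continuousWithinAt
      fun r hr => NNReal.coe_le_coe.2 hr
  increments t s := by
    have hm : ∀ t : ℝ≥0, AEMeasurable (fun ω => atomSum (J ω) (ξ ω) (Set.Iic (t : ℝ))) P :=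
      fun t => aemeasurable_atomSum hS hN.measurable hξ hsum measurableSet_Iic bddAbove_Iic
    have hL : ∀ (t : ℝ≥0), ∀ χ ∈ S,
        ∫⁻ ω, ENNReal.ofReal (χ (atomSum (J ω) (ξ ω) (Set.Iic (t : ℝ)))) ∂P =
          expNeg (t * ∫⁻ x, ENNReal.ofReal (1 - χ x) ∂ν) := fun t χ hχ => by
      rw [hN.lintegral_map_atomSum hS hξ hsum measurableSet_Iic bddAbove_Iic
        (hS.isCharacter χ hχ) (hS.continuous hχ), Set.inter_comm, Set.Ioi_inter_Iic]
      simp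
    let ρ : Measure M := P.map fun ω => atomSum (J ω) (ξ ω) (Set.Iic (s : ℝ))
    have : IsProbabilityMeasure ρ := Measure.isProbabilityMeasure_map (hm s)
    have hfst : AEMeasurable (fun ω' : Ω × M =>
        atomSum (J ω'.1) (ξ ω'.1) (Set.Iic (t : ℝ))) (P.prod ρ) :=
      (hm t).comp_quasiMeasurePreserving measurePreserving_fst.quasiMeasurePreserving
    have hadd : AEMeasurable (fun ω' : Ω × M =>
        ω'.2 + atomSum (J ω'.1) (ξ ω'.1) (Set.Iic (t : ℝ))) (P.prod ρ) :=
      measurable_snd.aemeasurable.add hfst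
    refine ⟨Ω × M, inferInstance, P.prod ρ, Prod.fst, Prod.snd, measurePreserving_fst,
      ⟨measurable_snd.aemeasurable, hm s, measurePreserving_snd.map_eq⟩,
      (indepFun_prod₀ (hm t) (aemeasurable_id (μ := ρ))).symm, hm (s + t), hadd, ?_⟩
    have := Measure.isProbabilityMeasure_map (hm (s + t))
    have := Measure.isProbabilityMeasure_map hadd
    refine hS.measure_ext fun χ hχ => ?_
    have hχm : Measurable fun x => ENNReal.ofReal (χ x) :=
      (hS.isCharacter χ hχ).measurable.ennreal_ofReal
    rw [lintegral_map' hχm.aemeasurable (hm (s + t)), lintegral_map' hχm.aemeasurable hadd,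
      hL (s + t) χ hχ]
    have hmul : ∀ ω' : Ω × M,
        ENNReal.ofReal (χ (ω'.2 + atomSum (J ω'.1) (ξ ω'.1) (Set.Iic (t : ℝ)))) =
          ENNReal.ofReal (χ (atomSum (J ω'.1) (ξ ω'.1) (Set.Iic (t : ℝ)))) *
          ENNReal.ofReal (χ ω'.2) := fun ω' => by
      rw [(hS.isCharacter χ hχ).map_add, ENNReal.ofReal_mul ((hS.isCharacter χ hχ).nonneg _),
        mul_comm]
    simp only [hmul]
    rw [lintegral_prod_mul (f := fun ω => ENNReal.ofReal
        (χ (atomSum (J ω) (ξ ω) (Set.Iic (t : ℝ))))) (hχm.comp_aemeasurable (hm t))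
      hχm.aemeasurable, lintegral_map' hχm.aemeasurable (hm s), hL s χ hχ, hL t χ hχ,
      ← expNeg_add, ← add_mul, add_comm, ENNReal.coe_add]

end Laws

end FellerMonoid

theorem mainTheorem3 {M Ω : Type*}
    [AddCommMonoid M] [TopologicalSpace M] [ContinuousAdd M]
    [LocallyCompactSpace M] [SecondCountableTopology M] [T2Space M]
    [MeasurableSpace M] [BorelSpace M]
    (S : Set (M → ℝ)) (hS : FellerMonoid.IsDeterminingClass S)
    [MeasurableSpace Ω] (P : Measure Ω) [IsProbabilityMeasure P]
    (ν : Measure M) [SigmaFinite ν]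
    (hν : ∀ χ ∈ S, ∫⁻ x, ENNReal.ofReal (1 - χ x) ∂ν < ∞)
    (N : Ω → Measure (Set.Ioi (0 : ℝ) × M))
    (hN : FellerMonoid.IsPoissonPointProcess P N
      (((volume : Measure ℝ).comap (Subtype.val : Set.Ioi (0 : ℝ) → ℝ)).prod ν))
    (J : Ω → Set ℕ) (ξ : Ω → ℕ → Set.Ioi (0 : ℝ) × M)
    (hξ : ∀ᵐ ω ∂P, N ω = Measure.sum (fun i : J ω => Measure.dirac (ξ ω i))) :
    -- the sums defining the process and its increments converge, and are additive
    (∀ᵐ ω ∂P, ∀ t : ℝ≥0, FellerMonoid.AtomSummable (J ω) (ξ ω) (Set.Iic t)) ∧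
    (∀ᵐ ω ∂P, ∀ s t : ℝ≥0, s ≤ t →
      FellerMonoid.AtomSummable (J ω) (ξ ω) (Set.Ioc s t) ∧
      FellerMonoid.atomSum (J ω) (ξ ω) (Set.Iic t) =
        FellerMonoid.atomSum (J ω) (ξ ω) (Set.Iic s) +
          FellerMonoid.atomSum (J ω) (ξ ω) (Set.Ioc s t)) ∧
    -- the process is a subordinator
    FellerMonoid.IsSubordinator P
      (fun (t : ℝ≥0) ω => FellerMonoid.atomSum (J ω) (ξ ω) (Set.Iic t)) ∧
    -- its increments are stationary
    (∀ t s : ℝ≥0, IdentDistrib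
      (fun ω => FellerMonoid.atomSum (J ω) (ξ ω) (Set.Ioc t (t + s)))
      (fun ω => FellerMonoid.atomSum (J ω) (ξ ω) (Set.Iic s)) P P) ∧
    -- its increments are independent
    (∀ t : ℕ → ℝ≥0, Monotone t →
      iIndepFun (fun k ω =>
        FellerMonoid.atomSum (J ω) (ξ ω) (Set.Ioc (t k) (t (k + 1)))) P) := by
  have hsum := hN.ae_locallySummable hS hν hξ
  refine ⟨?_, ?_, hN.isSubordinator_atomSum hS hξ hsum, fun t s => ?_, fun t ht => ?_⟩
  · filter_upwards [hsum] with ω hω t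
    exact hω.atomSummable hS bddAbove_Iic
  · filter_upwards [hsum] with ω hω s t hst
    exact ⟨hω.atomSummable hS bddAbove_Ioc, hω.atomSum_Iic_eq_add hS (NNReal.coe_le_coe.2 hst)⟩
  · refine hN.identDistrib_atomSum hS hξ hsum measurableSet_Ioc bddAbove_Ioc measurableSet_Iic
      bddAbove_Iic ?_
    have h1 : Set.Ioc (t : ℝ) (t + s) ∩ Set.Ioi 0 = Set.Ioc (t : ℝ) (t + s) :=
      Set.inter_eq_left.2 fun x hx => lt_of_le_of_lt t.coe_nonneg hx.1
    rw [h1, Set.inter_comm, Set.Ioi_inter_Iic]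
    simp
  · rw [iIndepFun_iff_finset]
    intro u
    have hmono : Monotone fun k => (t k : ℝ) := fun i j h => NNReal.coe_le_coe.2 (ht h)
    exact hN.iIndepFun_atomSum hS hξ hsum (ι := u)
      (B := fun k => Set.Ioc (t k : ℝ) (t (k + 1))) (fun _ => measurableSet_Ioc)
      (fun _ => bddAbove_Ioc) fun j k hjk =>
        hmono.pairwise_disjoint_on_Ioc_succ (Subtype.coe_injective.ne hjk)
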